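/- Let $E$ and $F$ be complex Banach spaces, let $U\subseteq E$ be open, let $1\le p\le\infty$, and let $p^*$ be the conjugate index of $p$ ($1/p+1/p^*=1$). For a complex normed space $X$ and $1\le r\le\infty$, write $\|(x_1,\dots,x_n)\|_{\ell_r^n(X)}$ for the $\ell_r$-norm of $(\|x_1\|,\dots,\|x_n\|)$ and $$\|(x_1,\dots,x_n)\|_{\ell_r^{n,w}(X)}=\sup_{x^*\in B_{X^*}}\|(x^*(x_1),\dots,x^*(x_n))\|_{\ell_r^n(\mathbb C)},$$ where $B_{X^*}$ is the closed unit ball of $X^*$. Let $\mathcal H^\infty(U)$ be the Banach space of bounded holomorphic functions $U\to\mathbb C$ with the supremum norm. For $x\in U$ let $\delta(x)\in\mathcal H^\infty(U)^*$ be evaluation at $x$, and let $\mathcal G^\infty(U)$ be the norm-closed linear span of $\{\delta(x):x\in U\}$ in $\mathcal H^\infty(U)^*$. Let $\mathcal G^\infty(U)\widehat\otimes_{g_p}F$ be the completion of the algebraic tensor product $\mathcal G^\infty(U)\otimes F$ with respect to the Chevet--Saphar norm $$g_p(u)=\inf\Big\{\|(\gamma_1,\dots,\gamma_n)\|_{\ell_p^n(\mathcal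 G^\infty(U))}\,\|(y_1,\dots,y_n)\|_{\ell_{p^*}^{n,w}(F)}:\ u=\sum_{i=1}^n\gamma_i\otimes y_i\Big\}.$$ For a complex Banach space $Y$, a holomorphic map $f\colon U\to Y$ is called Cohen strongly $p$-summing if there is a constant $C\ge 0$ such that $$\sum_{i=1}^n|\lambda_i|\,|\langle y_i^*,f(x_i)\rangle|\le C\,\|(\lambda_1,\dots,\lambda_n)\|_{\ell_p^n(\mathbb C)}\,\|(y_1^*,\dots,y_n^*)\|_{\ell_{p^*}^{n,w}(Y^*)}$$ for all $n\in\mathbb N$, $\lambda_i\in\mathbb C$, $x_i\in U$ and $y_i^*\in Y^*$. The infimum of such $C$ is denoted $d_p^{\mathcal H^\infty}(f)$, and $\mathcal D_p^{\mathcal H^\infty}(U,Y)$ is the space of all such maps with the norm $d_p^{\mathcal H^\infty}$. **Theorem.** There is an isometric linear isomorphism $\Lambda$ from $(\mathcal D_p^{\mathcal H^\infty}(U,F^*),d_p^{\mathcal H^\infty})$ onto $(\mathcal G^\infty(U)\widehat\otimes_{g_p}F)^*$ such that $$\Lambda(f)\Big(\sum_{i=1}^n\lambda_i\,\delta(x_i)\otimes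 y_i\Big)=\sum_{i=1}^n\lambda_i\langle f(x_i),y_i\rangle$$ for all $f\in\mathcal D_p^{\mathcal H^\infty}(U,F^*)$, $n\in\mathbb N$, $\lambda_i\in\mathbb C$, $x_i\in U$ and $y_i\in F$, and its inverse is given by $$\langle\Lambda^{-1}(\varphi)(x),y\rangle=\varphi(\delta(x)\otimes y)$$ for all $\varphi\in(\mathcal G^\infty(U)\widehat\otimes_{g_p}F)^*$, $x\in U$ and $y\in F$. -/

import Mathlib

open scoped ENNReal TensorProduct

noncomputable section

namespace CohenHolomorphic

universe u v

/-! ### Strong and weak `ℓ_p` norms of finite families -/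

section Families

variable {E : Type u} [NormedAddCommGroup E]

/-- The norm of `(x₁, …, xₙ)` in `ℓ_p^n(E)`. -/
def strongNorm (p : ℝ≥0∞) {n : ℕ} (x : Fin n → E) : ℝ :=
  ‖(WithLp.toLp p x : PiLp p fun _ : Fin n => E)‖

/-- The norm of `(x₁, …, xₙ)` in `ℓ_p^{n,w}(E)`: the supremum over the closed unit ball of `E*` of
the `ℓ_p^n`-norms of `(x*(x₁), …, x*(xₙ))`. -/
def weakNorm [NormedSpace ℂ E] (p : ℝ≥0∞) {n : ℕ} (x : Fin n → E) : ℝ :=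
  ⨆ φ : Metric.closedBall (0 : StrongDual ℂ E) 1, strongNorm p fun i => φ.1 (x i)

/-- The conjugate index `p*`. -/
def conjIndex (p : ℝ≥0∞) : ℝ≥0∞ := 1 + (p - 1)⁻¹

theorem conjIndex_one : conjIndex 1 = ∞ := by simp [conjIndex]

theorem conjIndex_top : conjIndex ∞ = 1 := by simp [conjIndex]

theorem one_le_conjIndex (p : ℝ≥0∞) : 1 ≤ conjIndex p := by simp [conjIndex]

instance (p : ℝ≥0∞) : Fact (1 ≤ conjIndex p) := ⟨one_le_conjIndex p⟩

theorem conjIndex_of_lt {p : ℝ≥0∞} (h1 : 1 < p) (hp : p ≠ ∞) :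
    p.toReal.HolderConjugate (conjIndex p).toReal := by
  have h1r : 1 < p.toReal := by
    rw [← ENNReal.toReal_one]
    exact (ENNReal.toReal_lt_toReal ENNReal.one_ne_top hp).2 h1
  have hs : (conjIndex p).toReal = p.toReal.conjExponent := by
    have h0 : p - 1 ≠ 0 := (tsub_pos_of_lt h1).ne'
    have hne : p.toReal - 1 ≠ 0 := by linarith
    rw [conjIndex, ENNReal.toReal_add ENNReal.one_ne_top (ENNReal.inv_ne_top.2 h0),
      ENNReal.toReal_inv, ENNReal.toReal_sub_of_le h1.le hp, ENNReal.toReal_one,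
      Real.conjExponent]
    field_simp
    ring
  rw [hs]
  exact Real.HolderConjugate.conjExponent h1r

theorem inv_add_inv_conjIndex {p : ℝ≥0∞} (hp : 1 ≤ p) :
    p.toReal⁻¹ + (conjIndex p).toReal⁻¹ = 1 := by
  rcases eq_or_lt_of_le hp with rfl | h1
  · simp [conjIndex_one]
  · by_cases ht : p = ∞
    · subst ht; simp [conjIndex_top]
    · exact (conjIndex_of_lt h1 ht).inv_add_inv_eq_one

theorem strongNorm_top {n : ℕ} (x : Fin n → E) : strongNorm ∞ x = ⨆ i, ‖x i‖ := rfl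

theorem strongNorm_eq_sum {p : ℝ≥0∞} (hp : 1 ≤ p) (ht : p ≠ ∞) {n : ℕ} (x : Fin n → E) :
    strongNorm p x = (∑ i, ‖x i‖ ^ p.toReal) ^ (1 / p.toReal) :=
  PiLp.norm_eq_sum (ENNReal.toReal_pos (by positivity) ht) _

variable (p : ℝ≥0∞) [hp : Fact (1 ≤ p)]

theorem strongNorm_nonneg {n : ℕ} (x : Fin n → E) : 0 ≤ strongNorm p x := norm_nonneg _

theorem strongNorm_smul [NormedSpace ℂ E] {n : ℕ} (c : ℂ) (x : Fin n → E) :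
    strongNorm p (fun i => c • x i) = ‖c‖ * strongNorm p x :=
  norm_smul c (WithLp.toLp p x : PiLp p fun _ : Fin n => E)

theorem strongNorm_mono {F : Type v} [NormedAddCommGroup F] {n : ℕ} {x : Fin n → E} {y : Fin n → F}
    (h : ∀ i, ‖x i‖ ≤ ‖y i‖) : strongNorm p x ≤ strongNorm p y := by
  by_cases ht : p = ∞
  · subst ht
    exact ciSup_mono (Finite.bddAbove_range _) h
  · rw [strongNorm_eq_sum hp.out ht, strongNorm_eq_sum hp.out ht]
    gcongr with i
    exact h i

theorem strongNorm_append {a b : ℝ} (ha : 0 ≤ a) (hb : 0 ≤ b) {n m : ℕ} {x : Fin n → E}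
    {y : Fin m → E} (hx : strongNorm p x ≤ a ^ p.toReal⁻¹) (hy : strongNorm p y ≤ b ^ p.toReal⁻¹) :
    strongNorm p (Fin.append x y) ≤ (a + b) ^ p.toReal⁻¹ := by
  by_cases ht : p = ∞
  · subst ht
    simp only [ENNReal.toReal_top, inv_zero, Real.rpow_zero] at hx hy ⊢
    refine Real.iSup_le (fun i => ?_) zero_le_one
    refine Fin.addCases (fun j => ?_) (fun j => ?_) i
    · simpa using (PiLp.norm_apply_le (WithLp.toLp ∞ x : PiLp ∞ fun _ : Fin n => E) j).trans hx
    · simpa using (PiLp.norm_apply_le (WithLp.toLp ∞ y : PiLp ∞ fun _ : Fin m => E) j).trans hy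
  · have h0 : 0 < p.toReal := ENNReal.toReal_pos (zero_lt_one.trans_le hp.out).ne' ht
    rw [strongNorm_eq_sum hp.out ht, one_div] at *
    have hx' := (Real.rpow_le_rpow_iff (by positivity) ha (inv_pos.2 h0)).1 hx
    have hy' := (Real.rpow_le_rpow_iff (by positivity) hb (inv_pos.2 h0)).1 hy
    refine Real.rpow_le_rpow (by positivity) ?_ (inv_pos.2 h0).le
    rw [Fin.sum_univ_add]
    simpa using add_le_add hx' hy'

variable [NormedSpace ℂ E]

theorem weakNorm_bddAbove {n : ℕ} (x : Fin n → E) :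
    BddAbove (Set.range fun φ : Metric.closedBall (0 : StrongDual ℂ E) 1 =>
      strongNorm p fun i => φ.1 (x i)) := by
  refine ⟨strongNorm p x, ?_⟩
  rintro _ ⟨φ, rfl⟩
  refine strongNorm_mono p fun i => ?_
  have h := φ.2
  rw [mem_closedBall_zero_iff] at h
  simpa using φ.1.le_of_opNorm_le h (x i)

theorem le_weakNorm {n : ℕ} (x : Fin n → E) {φ : StrongDual ℂ E} (h : ‖φ‖ ≤ 1) :
    strongNorm p (fun i => φ (x i)) ≤ weakNorm p x :=
  le_ciSup (weakNorm_bddAbove p x) ⟨φ, mem_closedBall_zero_iff.2 h⟩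

theorem weakNorm_nonneg {n : ℕ} (x : Fin n → E) : 0 ≤ weakNorm p x :=
  Real.iSup_nonneg fun _ => strongNorm_nonneg p _

theorem weakNorm_smul {n : ℕ} (c : ℂ) (x : Fin n → E) :
    weakNorm p (fun i => c • x i) = ‖c‖ * weakNorm p x := by
  rw [weakNorm, weakNorm, Real.mul_iSup_of_nonneg (norm_nonneg c)]
  congr 1
  ext φ
  rw [← strongNorm_smul]
  simp

theorem weakNorm_append {a b : ℝ} (ha : 0 ≤ a) (hb : 0 ≤ b) {n m : ℕ} {x : Fin n → E}
    {y : Fin m → E} (hx : weakNorm p x ≤ a ^ p.toReal⁻¹) (hy : weakNorm p y ≤ b ^ p.toReal⁻¹) :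
    weakNorm p (Fin.append x y) ≤ (a + b) ^ p.toReal⁻¹ := by
  refine Real.iSup_le (fun φ => ?_) (by positivity)
  have hφ := mem_closedBall_zero_iff.1 φ.2
  have h : (fun i => φ.1 (Fin.append x y i)) =
      Fin.append (fun i => φ.1 (x i)) (fun i => φ.1 (y i)) := by
    ext i
    refine Fin.addCases (fun j => ?_) (fun j => ?_) i <;> simp
  rw [h]
  exact strongNorm_append p ha hb ((le_weakNorm p x hφ).trans hx) ((le_weakNorm p y hφ).trans hy)

/-- Hölder's inequality for finite families of scalars. -/
theorem norm_sum_mul_le {n : ℕ} (x y : Fin n → ℂ) :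
    ‖∑ i, x i * y i‖ ≤ strongNorm p x * strongNorm (conjIndex p) y := by
  refine (norm_sum_le _ _).trans ?_
  simp_rw [norm_mul]
  by_cases h1 : p = 1
  · subst h1
    rw [conjIndex_one, strongNorm_eq_sum le_rfl ENNReal.one_ne_top]
    simp only [ENNReal.toReal_one, Real.rpow_one, div_one, Finset.sum_mul]
    gcongr with i
    exact PiLp.norm_apply_le (WithLp.toLp ∞ y : PiLp ∞ fun _ : Fin n => ℂ) i
  by_cases ht : p = ∞
  · subst ht
    rw [conjIndex_top, strongNorm_eq_sum le_rfl ENNReal.one_ne_top]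
    simp only [ENNReal.toReal_one, Real.rpow_one, div_one, Finset.mul_sum]
    gcongr with i
    exact PiLp.norm_apply_le (WithLp.toLp ∞ x : PiLp ∞ fun _ : Fin n => ℂ) i
  have hc := conjIndex_of_lt (lt_of_le_of_ne hp.out (Ne.symm h1)) ht
  have hq : conjIndex p ≠ ∞ := fun h => by
    have := hc.symm.pos
    simp [h] at this
  rw [strongNorm_eq_sum hp.out ht, strongNorm_eq_sum (one_le_conjIndex p) hq]
  exact Real.inner_le_Lp_mul_Lq_of_nonneg _ hc (fun _ _ => norm_nonneg _) (fun _ _ => norm_nonneg _)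

end Families

/-! ### The Chevet–Saphar tensor norm `g_p` -/

section ChevetSaphar

/-- The algebraic tensor product `E ⊗ F`, to be equipped with the norm `g_p`. -/
def ChevetSaphar (_p : ℝ≥0∞) (E : Type u) (F : Type v) [NormedAddCommGroup E] [NormedSpace ℂ E]
    [NormedAddCommGroup F] [NormedSpace ℂ F] : Type (max u v) := E ⊗[ℂ] F

variable (p : ℝ≥0∞) {E : Type u} {F : Type v} [NormedAddCommGroup E] [NormedSpace ℂ E]
  [NormedAddCommGroup F] [NormedSpace ℂ F]

instance : AddCommGroup (ChevetSaphar p E F) := inferInstanceAs (AddCommGroup (E ⊗[ℂ] F))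

instance : Module ℂ (ChevetSaphar p E F) := inferInstanceAs (Module ℂ (E ⊗[ℂ] F))

/-- The elementary tensor `x ⊗ y` in `E ⊗ F`. -/
def ChevetSaphar.tmul (x : E) (y : F) : ChevetSaphar p E F := x ⊗ₜ[ℂ] y

/-- The numbers `‖(xᵢ)‖_{ℓ_p^n(E)} ‖(yᵢ)‖_{ℓ_{p*}^{n,w}(F)}`, for all representations
`u = ∑ xᵢ ⊗ yᵢ`. -/
def ChevetSaphar.values (w : ChevetSaphar p E F) : Set ℝ :=
  {r | ∃ (n : ℕ) (x : Fin n → E) (y : Fin n → F),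
    w = ∑ i, ChevetSaphar.tmul p (x i) (y i) ∧ r = strongNorm p x * weakNorm (conjIndex p) y}

/-- The Chevet–Saphar norm `g_p`. -/
instance : Norm (ChevetSaphar p E F) := ⟨fun w => sInf (ChevetSaphar.values p w)⟩

theorem ChevetSaphar.norm_def (w : ChevetSaphar p E F) :
    ‖w‖ = sInf (ChevetSaphar.values p w) := rfl

theorem ChevetSaphar.tmul_smul (c : ℂ) (x : E) (y : F) :
    ChevetSaphar.tmul p x (c • y) = c • ChevetSaphar.tmul p x y :=
  TensorProduct.tmul_smul c x y

theorem ChevetSaphar.smul_tmul (c : ℂ) (x : E) (y : F) :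
    ChevetSaphar.tmul p (c • x) y = c • ChevetSaphar.tmul p x y :=
  (TensorProduct.smul_tmul' c x y).symm

theorem ChevetSaphar.exists_rep (w : ChevetSaphar p E F) :
    ∃ (n : ℕ) (x : Fin n → E) (y : Fin n → F), w = ∑ i, ChevetSaphar.tmul p (x i) (y i) := by
  induction w using TensorProduct.induction_on with
  | zero => exact ⟨0, Fin.elim0, Fin.elim0, by simp; rfl⟩
  | tmul x y => exact ⟨1, fun _ => x, fun _ => y, by simp; rfl⟩
  | add a b ha hb =>
    obtain ⟨n, x, y, h⟩ := ha
    obtain ⟨m, x', y', h'⟩ := hb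
    refine ⟨n + m, Fin.append x x', Fin.append y y', ?_⟩
    rw [Fin.sum_univ_add]
    simp only [Fin.append_left, Fin.append_right]
    rw [← h, ← h']
    rfl

theorem ChevetSaphar.values_nonempty (w : ChevetSaphar p E F) :
    (ChevetSaphar.values p w).Nonempty := by
  obtain ⟨n, x, y, h⟩ := ChevetSaphar.exists_rep p w
  exact ⟨_, n, x, y, h, rfl⟩

variable [hp : Fact (1 ≤ p)]

theorem ChevetSaphar.values_nonneg (w : ChevetSaphar p E F) :
    ∀ r ∈ ChevetSaphar.values p w, 0 ≤ r := by
  rintro _ ⟨n, x, y, -, rfl⟩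
  exact mul_nonneg (strongNorm_nonneg p x) (weakNorm_nonneg _ y)

theorem ChevetSaphar.norm_le {n : ℕ} (x : Fin n → E) (y : Fin n → F) :
    ‖∑ i, ChevetSaphar.tmul p (x i) (y i)‖ ≤ strongNorm p x * weakNorm (conjIndex p) y :=
  csInf_le ⟨0, ChevetSaphar.values_nonneg p _⟩ ⟨n, x, y, rfl, rfl⟩

/-- Every representation can be rescaled so as to balance its two factors. -/
theorem ChevetSaphar.exists_balanced {w : ChevetSaphar p E F} {c : ℝ} (h : ‖w‖ < c) :
    ∃ (n : ℕ) (x : Fin n → E) (y : Fin n → F), w = ∑ i, ChevetSaphar.tmul p (x i) (y i) ∧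
      strongNorm p x ≤ c ^ p.toReal⁻¹ ∧
      weakNorm (conjIndex p) y ≤ c ^ (conjIndex p).toReal⁻¹ := by
  obtain ⟨r, ⟨n, x, y, hw, rfl⟩, hr⟩ :=
    exists_lt_of_csInf_lt (ChevetSaphar.values_nonempty p w) h
  have hA := strongNorm_nonneg p x
  have hB := weakNorm_nonneg (conjIndex p) y
  have hc : 0 < c := (mul_nonneg hA hB).trans_lt hr
  obtain ⟨t, ht, h1, h2⟩ : ∃ t : ℝ, 0 < t ∧ t * strongNorm p x ≤ c ^ p.toReal⁻¹ ∧
      t⁻¹ * weakNorm (conjIndex p) y ≤ c ^ (conjIndex p).toReal⁻¹ := by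
    have hcp : 0 < c ^ p.toReal⁻¹ := by positivity
    have hcq : 0 < c ^ (conjIndex p).toReal⁻¹ := by positivity
    have hcc : c ^ p.toReal⁻¹ * c ^ (conjIndex p).toReal⁻¹ = c := by
      rw [← Real.rpow_add hc, inv_add_inv_conjIndex hp.out, Real.rpow_one]
    rcases hA.eq_or_lt with h0 | h0
    · refine ⟨(weakNorm (conjIndex p) y + 1) / c ^ (conjIndex p).toReal⁻¹, by positivity, ?_, ?_⟩
      · rw [← h0, mul_zero]; exact hcp.le
      · rw [inv_div, div_mul_eq_mul_div, div_le_iff₀ (by positivity)]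
        gcongr
        linarith
    · refine ⟨c ^ p.toReal⁻¹ / strongNorm p x, by positivity, ?_, ?_⟩
      · rw [div_mul_cancel₀ _ h0.ne']
      · rw [inv_div, div_mul_eq_mul_div, div_le_iff₀ hcp, mul_comm (c ^ (conjIndex p).toReal⁻¹), hcc]
        exact hr.le
  have hn : ‖(t : ℂ)‖ = t := by simp [abs_of_pos ht]
  have htc : (t : ℂ) ≠ 0 := by exact_mod_cast ht.ne'
  refine ⟨n, fun i => (t : ℂ) • x i, fun i => (t : ℂ)⁻¹ • y i, ?_, ?_, ?_⟩
  · rw [hw]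
    refine Finset.sum_congr rfl fun i _ => ?_
    rw [ChevetSaphar.smul_tmul, ChevetSaphar.tmul_smul, smul_smul, mul_inv_cancel₀ htc, one_smul]
  · rw [strongNorm_smul, hn]; exact h1
  · rw [weakNorm_smul, norm_inv, hn]; exact h2

theorem ChevetSaphar.norm_smul_le (c : ℂ) (w : ChevetSaphar p E F) : ‖c • w‖ ≤ ‖c‖ * ‖w‖ := by
  rw [ChevetSaphar.norm_def p w, ← smul_eq_mul, ← Real.sInf_smul_of_nonneg (norm_nonneg c)]
  refine le_csInf ((ChevetSaphar.values_nonempty p w).smul_set) ?_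
  rintro _ ⟨_, ⟨n, x, y, hw, rfl⟩, rfl⟩
  have h : c • w = ∑ i, ChevetSaphar.tmul p (c • x i) (y i) := by
    simp only [hw, Finset.smul_sum, ChevetSaphar.smul_tmul]
  rw [h]
  refine (ChevetSaphar.norm_le p _ _).trans_eq ?_
  rw [strongNorm_smul, mul_assoc]
  rfl

theorem ChevetSaphar.norm_add_le (w w' : ChevetSaphar p E F) : ‖w + w'‖ ≤ ‖w‖ + ‖w'‖ := by
  refine le_of_forall_pos_le_add fun ε hε => ?_
  have hw0 : 0 ≤ ‖w‖ := Real.sInf_nonneg (ChevetSaphar.values_nonneg p w)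
  have hw0' : 0 ≤ ‖w'‖ := Real.sInf_nonneg (ChevetSaphar.values_nonneg p w')
  obtain ⟨n, x, y, hw, hx, hy⟩ :=
    ChevetSaphar.exists_balanced p (show ‖w‖ < ‖w‖ + ε / 2 by linarith)
  obtain ⟨m, x', y', hw', hx', hy'⟩ :=
    ChevetSaphar.exists_balanced p (show ‖w'‖ < ‖w'‖ + ε / 2 by linarith)
  have h : w + w' =
      ∑ i, ChevetSaphar.tmul p (Fin.append x x' i) (Fin.append y y' i) := by
    rw [Fin.sum_univ_add]
    simp only [Fin.append_left, Fin.append_right]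
    rw [← hw, ← hw']
  have ha : 0 ≤ ‖w‖ + ε / 2 := by linarith
  have hb : 0 ≤ ‖w'‖ + ε / 2 := by linarith
  have hs : 0 < ‖w‖ + ε / 2 + (‖w'‖ + ε / 2) := by linarith
  calc ‖w + w'‖ ≤ strongNorm p (Fin.append x x') * weakNorm (conjIndex p) (Fin.append y y') := by
        rw [h]; exact ChevetSaphar.norm_le p _ _
    _ ≤ (‖w‖ + ε / 2 + (‖w'‖ + ε / 2)) ^ p.toReal⁻¹ *
        (‖w‖ + ε / 2 + (‖w'‖ + ε / 2)) ^ (conjIndex p).toReal⁻¹ :=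
        mul_le_mul (strongNorm_append p ha hb hx hx') (weakNorm_append _ ha hb hy hy')
          (weakNorm_nonneg _ _) (by positivity)
    _ = ‖w‖ + ‖w'‖ + ε := by
        rw [← Real.rpow_add hs, inv_add_inv_conjIndex hp.out, Real.rpow_one]; ring

/-- Pairs of continuous functionals separate the points of `E ⊗ F`. -/
theorem tensor_eq_zero_of_forall {w : E ⊗[ℂ] F}
    (h : ∀ (φ : StrongDual ℂ E) (ψ : StrongDual ℂ F),
      LinearMap.mul' ℂ ℂ (TensorProduct.map φ.toLinearMap ψ.toLinearMap w) = 0) : w = 0 := by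
  classical
  let b := Module.Basis.ofVectorSpace ℂ F
  refine (LinearEquiv.map_eq_zero_iff (TensorProduct.equivFinsuppOfBasisRight (M := E) b)).1 ?_
  ext k
  refine SeparatingDual.eq_zero_of_forall_dual_eq_zero (R := ℂ) fun φ => ?_
  have h1 : ∀ ψ : StrongDual ℂ F, ψ (TensorProduct.lid ℂ F (φ.toLinearMap.rTensor F w)) = 0 := by
    intro ψ
    rw [← h φ ψ]
    clear h
    induction w using TensorProduct.induction_on with
    | zero => simp
    | tmul x y => simp
    | add a b ha hb => simp only [map_add, ha, hb]
  have h2 := SeparatingDual.eq_zero_of_forall_dual_eq_zero (R := ℂ) h1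
  have h3 : b.repr (TensorProduct.lid ℂ F (φ.toLinearMap.rTensor F w)) k =
      φ (TensorProduct.equivFinsuppOfBasisRight b w k) := by
    clear h h1 h2
    induction w using TensorProduct.induction_on with
    | zero => simp
    | tmul x y => simp [mul_comm]
    | add a b ha hb => simp only [map_add, Finsupp.add_apply, ha, hb]
  rw [← h3, h2]
  simp

theorem ChevetSaphar.eq_zero_of_norm {w : ChevetSaphar p E F} (h : ‖w‖ = 0) : w = 0 := by
  refine tensor_eq_zero_of_forall (w := w) fun φ ψ => ?_
  have key : ∀ r ∈ ChevetSaphar.values p w,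
      ‖LinearMap.mul' ℂ ℂ (TensorProduct.map φ.toLinearMap ψ.toLinearMap w)‖ ≤
        (‖φ‖ * (‖ψ‖ + 1)) * r := by
    rintro _ ⟨n, x, y, hw, rfl⟩
    have h1 : LinearMap.mul' ℂ ℂ (TensorProduct.map φ.toLinearMap ψ.toLinearMap w) =
        ∑ i, φ (x i) * ψ (y i) := by
      have hw' : w = ∑ i, (x i ⊗ₜ[ℂ] y i : E ⊗[ℂ] F) := hw
      rw [hw', map_sum, map_sum]
      simp
    have h2 : strongNorm p (fun i => φ (x i)) ≤ ‖φ‖ * strongNorm p x := by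
      have := strongNorm_mono p (x := fun i => φ (x i)) (y := fun i => (‖φ‖ : ℂ) • x i)
        fun i => by simpa [norm_smul] using φ.le_opNorm (x i)
      rw [strongNorm_smul] at this
      simpa using this
    have h3 : strongNorm (conjIndex p) (fun i => ψ (y i)) ≤
        (‖ψ‖ + 1) * weakNorm (conjIndex p) y := by
      have hpos : 0 < ‖ψ‖ + 1 := by positivity
      have hn : ‖((‖ψ‖ + 1 : ℝ) : ℂ)‖ = ‖ψ‖ + 1 := by
        rw [Complex.norm_real, Real.norm_of_nonneg hpos.le]
      have h4 := le_weakNorm (conjIndex p) y (φ := (((‖ψ‖ + 1 : ℝ) : ℂ)⁻¹) • ψ) (by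
        rw [norm_smul, norm_inv, hn, inv_mul_le_iff₀ hpos]; linarith)
      have h5 := strongNorm_smul (conjIndex p) (((‖ψ‖ + 1 : ℝ) : ℂ)⁻¹) fun i => ψ (y i)
      rw [norm_inv, hn] at h5
      have h6 : strongNorm (conjIndex p) (fun i => ((((‖ψ‖ + 1 : ℝ) : ℂ)⁻¹) • ψ) (y i)) =
          (‖ψ‖ + 1)⁻¹ * strongNorm (conjIndex p) fun i => ψ (y i) := h5
      rw [h6, inv_mul_le_iff₀ hpos] at h4
      exact h4
    rw [h1]
    calc ‖∑ i, φ (x i) * ψ (y i)‖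
        ≤ strongNorm p (fun i => φ (x i)) * strongNorm (conjIndex p) fun i => ψ (y i) :=
          norm_sum_mul_le p _ _
      _ ≤ (‖φ‖ * strongNorm p x) * ((‖ψ‖ + 1) * weakNorm (conjIndex p) y) :=
          mul_le_mul h2 h3 (strongNorm_nonneg _ _)
            (mul_nonneg (norm_nonneg _) (strongNorm_nonneg _ _))
      _ = _ := by ring
  have hK : 0 ≤ ‖φ‖ * (‖ψ‖ + 1) := by positivity
  have h0 : ‖LinearMap.mul' ℂ ℂ (TensorProduct.map φ.toLinearMap ψ.toLinearMap w)‖ ≤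
      (‖φ‖ * (‖ψ‖ + 1)) * ‖w‖ := by
    rw [ChevetSaphar.norm_def p w, ← smul_eq_mul, ← Real.sInf_smul_of_nonneg hK]
    refine le_csInf ((ChevetSaphar.values_nonempty p w).smul_set) ?_
    rintro _ ⟨r, hr, rfl⟩
    exact key r hr
  rw [h, mul_zero] at h0
  exact norm_le_zero_iff.1 h0

theorem ChevetSaphar.core : NormedSpace.Core ℂ (ChevetSaphar p E F) where
  norm_nonneg w := Real.sInf_nonneg (ChevetSaphar.values_nonneg p w)
  norm_smul c w := by
    refine le_antisymm (ChevetSaphar.norm_smul_le p c w) ?_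
    by_cases hc : c = 0
    · rw [hc, norm_zero, zero_mul]
      exact Real.sInf_nonneg (ChevetSaphar.values_nonneg p _)
    · have h := ChevetSaphar.norm_smul_le p c⁻¹ (c • w)
      rwa [inv_smul_smul₀ hc, norm_inv, le_inv_mul_iff₀ (norm_pos_iff.2 hc)] at h
  norm_triangle := ChevetSaphar.norm_add_le p
  norm_eq_zero_iff w := by
    refine ⟨ChevetSaphar.eq_zero_of_norm p, ?_⟩
    rintro rfl
    refine le_antisymm ?_ (Real.sInf_nonneg (ChevetSaphar.values_nonneg p _))
    simpa using ChevetSaphar.norm_smul_le p 0 (0 : ChevetSaphar p E F)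

instance : NormedAddCommGroup (ChevetSaphar p E F) :=
  NormedAddCommGroup.ofCore (ChevetSaphar.core p)

instance : NormedSpace ℂ (ChevetSaphar p E F) :=
  NormedSpace.ofCore (ChevetSaphar.core p)

variable (E F) in
/-- The completion of `E ⊗ F` with respect to `g_p`. -/
abbrev CompletedChevetSaphar : Type (max u v) := UniformSpace.Completion (ChevetSaphar p E F)

/-- The elementary tensor `x ⊗ y` as an element of the completed tensor product. -/
def ctmul (x : E) (y : F) : CompletedChevetSaphar p E F :=
  ((ChevetSaphar.tmul p x y : ChevetSaphar p E F) : CompletedChevetSaphar p E F)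

end ChevetSaphar

/-! ### Bounded holomorphic mappings and the predual `G^∞(U)` -/

section Holomorphic

variable {E : Type u} [NormedAddCommGroup E] [NormedSpace ℂ E]
  {F : Type v} [NormedAddCommGroup F] [NormedSpace ℂ F]

/-- `f : U → F` is holomorphic: at each `a ∈ U` there is a bounded linear operator `T : E → F` with
`(f(x) - f(a) - T(x - a)) / ‖x - a‖ → 0` as `x → a`. -/
def IsHolomorphic (U : TopologicalSpace.Opens E) (f : U → F) : Prop :=
  ∀ a : U, ∃ T : E →L[ℂ] F,
    (fun x : U => f x - f a - T ((x : E) - (a : E))) =o[nhds a] fun x : U => (x : E) - (a : E)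

theorem IsHolomorphic.zero (U : TopologicalSpace.Opens E) :
    IsHolomorphic U (fun _ => (0 : F)) := fun a => ⟨0, by simp⟩

theorem IsHolomorphic.add {U : TopologicalSpace.Opens E} {f g : U → F} (hf : IsHolomorphic U f)
    (hg : IsHolomorphic U g) : IsHolomorphic U (fun x => f x + g x) := fun a => by
  obtain ⟨T, hT⟩ := hf a
  obtain ⟨S, hS⟩ := hg a
  refine ⟨T + S, (hT.add hS).congr_left fun x => ?_⟩
  simp only [add_apply]
  abel

theorem IsHolomorphic.smul {U : TopologicalSpace.Opens E} {f : U → F} (c : ℂ)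
    (hf : IsHolomorphic U f) : IsHolomorphic U (fun x => c • f x) := fun a => by
  obtain ⟨T, hT⟩ := hf a
  refine ⟨c • T, (hT.const_smul_left c).congr_left fun x => ?_⟩
  simp [smul_sub]

/-- The bounded holomorphic functions `U → ℂ`, inside the bounded continuous ones. -/
def hInfSubmodule (U : TopologicalSpace.Opens E) :
    Submodule ℂ (BoundedContinuousFunction U ℂ) where
  carrier := {f | IsHolomorphic U f}
  zero_mem' := IsHolomorphic.zero U
  add_mem' hf hg := IsHolomorphic.add hf hg
  smul_mem' c _ hf := IsHolomorphic.smul c hf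

/-- The space `H^∞(U)` of bounded holomorphic functions `U → ℂ`, with the supremum norm. -/
def HInf (U : TopologicalSpace.Opens E) : Type u := hInfSubmodule U

instance (U : TopologicalSpace.Opens E) : NormedAddCommGroup (HInf U) :=
  inferInstanceAs (NormedAddCommGroup (hInfSubmodule U))

instance (U : TopologicalSpace.Opens E) : NormedSpace ℂ (HInf U) :=
  inferInstanceAs (NormedSpace ℂ (hInfSubmodule U))

instance (U : TopologicalSpace.Opens E) : CoeFun (HInf U) fun _ => U → ℂ := ⟨fun f => f.1⟩

theorem HInf.norm_def {U : TopologicalSpace.Opens E} (f : HInf U) : ‖f‖ = ‖f.1‖ := rfl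

/-- The evaluation functional `δ(x)` on `H^∞(U)`. -/
def evalFunctional (U : TopologicalSpace.Opens E) (x : U) : StrongDual ℂ (HInf U) :=
  LinearMap.mkContinuous
    { toFun := fun f => f x
      map_add' := fun _ _ => rfl
      map_smul' := fun _ _ => rfl } 1
    fun f => by rw [one_mul]; exact f.1.norm_coe_le_norm x

theorem evalFunctional_apply (U : TopologicalSpace.Opens E) (x : U) (f : HInf U) :
    evalFunctional U x f = f x := rfl

/-- `G^∞(U)`: the norm-closed linear hull in `H^∞(U)*` of the evaluation functionals. -/
def GInf (U : TopologicalSpace.Opens E) : Submodule ℂ (StrongDual ℂ (HInf U)) :=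
  (Submodule.span ℂ (Set.range (evalFunctional U))).topologicalClosure

/-- `δ(x)` as an element of `G^∞(U)`. -/
def delta (U : TopologicalSpace.Opens E) (x : U) : GInf U :=
  ⟨evalFunctional U x, Submodule.le_topologicalClosure _ (Submodule.subset_span ⟨x, rfl⟩)⟩

end Holomorphic

/-! ### Cohen strongly `p`-summing holomorphic mappings -/

section Cohen

variable (p : ℝ≥0∞) {E : Type u} [NormedAddCommGroup E]
  (U : TopologicalSpace.Opens E) {F : Type v} [NormedAddCommGroup F] [NormedSpace ℂ F]

/-- The constants `C ≥ 0` with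
`∑ |λᵢ| |⟨yᵢ*, f(xᵢ)⟩| ≤ C ‖(λᵢ)‖_{ℓ_p^n} ‖(yᵢ*)‖_{ℓ_{p*}^{n,w}(F*)}` for all finite families. -/
def cohenConstants (f : U → F) : Set ℝ :=
  {C | 0 ≤ C ∧ ∀ (n : ℕ) (l : Fin n → ℂ) (x : Fin n → U) (y : Fin n → StrongDual ℂ F),
    ∑ i, ‖l i‖ * ‖y i (f (x i))‖ ≤ C * strongNorm p l * weakNorm (conjIndex p) y}

/-- `d_p^{H^∞}(f)`: the infimum of the admissible constants. -/
def cohenNorm (f : U → F) : ℝ := sInf (cohenConstants p U f)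

variable {U}

theorem cohenNorm_nonneg (f : U → F) : 0 ≤ cohenNorm p U f := Real.sInf_nonneg fun _ h => h.1

theorem cohenNorm_le {f : U → F} {C : ℝ} (h : C ∈ cohenConstants p U f) : cohenNorm p U f ≤ C :=
  csInf_le ⟨0, fun _ h => h.1⟩ h

theorem cohenConstants_zero : (0 : ℝ) ∈ cohenConstants p U (0 : U → F) :=
  ⟨le_rfl, fun n l x y => by simp⟩

theorem cohenConstants_add {f g : U → F} {C D : ℝ} (hf : C ∈ cohenConstants p U f)
    (hg : D ∈ cohenConstants p U g) : C + D ∈ cohenConstants p U (f + g) := by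
  refine ⟨add_nonneg hf.1 hg.1, fun n l x y => ?_⟩
  calc ∑ i, ‖l i‖ * ‖y i ((f + g) (x i))‖
      ≤ ∑ i, (‖l i‖ * ‖y i (f (x i))‖ + ‖l i‖ * ‖y i (g (x i))‖) := by
        gcongr with i
        rw [← mul_add, Pi.add_apply, map_add]
        gcongr
        exact norm_add_le _ _
    _ ≤ _ := by
        rw [Finset.sum_add_distrib, add_mul, add_mul]
        exact add_le_add (hf.2 n l x y) (hg.2 n l x y)

theorem cohenConstants_smul {f : U → F} (c : ℂ) {C : ℝ} (hf : C ∈ cohenConstants p U f) :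
    ‖c‖ * C ∈ cohenConstants p U (c • f) := by
  refine ⟨mul_nonneg (norm_nonneg _) hf.1, fun n l x y => ?_⟩
  calc ∑ i, ‖l i‖ * ‖y i ((c • f) (x i))‖ = ‖c‖ * ∑ i, ‖l i‖ * ‖y i (f (x i))‖ := by
        rw [Finset.mul_sum]
        refine Finset.sum_congr rfl fun i _ => ?_
        rw [Pi.smul_apply, map_smul, norm_smul]
        ring
    _ ≤ ‖c‖ * (C * strongNorm p l * weakNorm (conjIndex p) y) := by
        gcongr
        exact hf.2 n l x y
    _ = _ := by ring

variable [hp : Fact (1 ≤ p)]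

theorem cohenNorm_mem {f : U → F} (h : (cohenConstants p U f).Nonempty) :
    cohenNorm p U f ∈ cohenConstants p U f := by
  refine ⟨cohenNorm_nonneg p f, fun n l x y => ?_⟩
  have hK : 0 ≤ strongNorm p l * weakNorm (conjIndex p) y :=
    mul_nonneg (strongNorm_nonneg p l) (weakNorm_nonneg _ y)
  rw [mul_assoc, mul_comm, cohenNorm, ← smul_eq_mul, ← Real.sInf_smul_of_nonneg hK]
  refine le_csInf h.smul_set ?_
  rintro _ ⟨C, hC, rfl⟩
  refine (hC.2 n l x y).trans_eq ?_
  simp only [smul_eq_mul]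
  ring

variable (U) [NormedSpace ℂ E]

/-- `f` is a Cohen strongly `p`-summing holomorphic mapping. -/
def IsCohenSumming (f : U → F) : Prop :=
  IsHolomorphic U f ∧ (cohenConstants p U f).Nonempty

variable (F)

/-- The linear space of Cohen strongly `p`-summing holomorphic mappings, inside all mappings. -/
def cohenSubmodule : Submodule ℂ (U → F) where
  carrier := {f | IsCohenSumming p U f}
  zero_mem' := ⟨IsHolomorphic.zero U, 0, cohenConstants_zero p⟩
  add_mem' hf hg := by
    obtain ⟨hf1, C, hC⟩ := hf
    obtain ⟨hg1, D, hD⟩ := hg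
    exact ⟨hf1.add hg1, C + D, cohenConstants_add p hC hD⟩
  smul_mem' c f hf := by
    obtain ⟨hf1, C, hC⟩ := hf
    exact ⟨hf1.smul c, ‖c‖ * C, cohenConstants_smul p c hC⟩

/-- `D_p^{H^∞}(U, F)`, normed by `d_p^{H^∞}`. -/
def CohenSpace : Type (max u v) := cohenSubmodule p U F

instance : AddCommGroup (CohenSpace p U F) := inferInstanceAs (AddCommGroup (cohenSubmodule p U F))

instance : Module ℂ (CohenSpace p U F) := inferInstanceAs (Module ℂ (cohenSubmodule p U F))

instance : CoeFun (CohenSpace p U F) fun _ => U → F := ⟨Subtype.val⟩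

instance : Norm (CohenSpace p U F) := ⟨fun f => cohenNorm p U (f : U → F)⟩

theorem CohenSpace.core : NormedSpace.Core ℂ (CohenSpace p U F) := by
  have hle : ∀ (c : ℂ) (f : CohenSpace p U F), ‖c • f‖ ≤ ‖c‖ * ‖f‖ := fun c f =>
    cohenNorm_le p (cohenConstants_smul p c (cohenNorm_mem p f.2.2))
  refine ⟨⟨fun f => cohenNorm_nonneg p _, fun c f => ?_, fun f g => ?_⟩, fun f => ⟨fun h => ?_, ?_⟩⟩
  · refine le_antisymm (hle c f) ?_
    by_cases hc : c = 0
    · rw [hc, norm_zero, zero_mul]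
      exact cohenNorm_nonneg p _
    · have h := hle c⁻¹ (c • f)
      rwa [inv_smul_smul₀ hc, norm_inv, le_inv_mul_iff₀ (norm_pos_iff.2 hc)] at h
  · exact cohenNorm_le p (cohenConstants_add p (cohenNorm_mem p f.2.2) (cohenNorm_mem p g.2.2))
  · have h0 : (0 : ℝ) ∈ cohenConstants p U (f : U → F) := by
      have := cohenNorm_mem p f.2.2
      rwa [show cohenNorm p U f.1 = 0 from h] at this
    refine Subtype.ext (funext fun x => ?_)
    refine SeparatingDual.eq_zero_of_forall_dual_eq_zero (R := ℂ) fun y => ?_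
    have h1 := h0.2 1 (fun _ => 1) (fun _ => x) fun _ => y
    simp only [Fin.sum_univ_one, norm_one, one_mul, zero_mul] at h1
    exact norm_le_zero_iff.1 h1
  · rintro rfl
    exact le_antisymm (cohenNorm_le p (cohenConstants_zero p)) (cohenNorm_nonneg p _)

instance : NormedAddCommGroup (CohenSpace p U F) := NormedAddCommGroup.ofCore (CohenSpace.core p U F)

instance : NormedSpace ℂ (CohenSpace p U F) := NormedSpace.ofCore (CohenSpace.core p U F)

end Cohen

end CohenHolomorphic

end

open CohenHolomorphic

open scoped ENNReal TensorProduct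

noncomputable section

namespace CohenHolomorphic

universe u v

/-! ### The evaluation map `δ : U → G^∞(U)` is holomorphic -/

section Holomorphic

section ZeroExtend

variable {E : Type u} [NormedAddCommGroup E] {F : Type v} [NormedAddCommGroup F]
  {U : TopologicalSpace.Opens E}

/-! A functional `φ` on the completed tensor product is the same as a bounded operator `T : G^∞(U) →
F*`, `T γ y = φ (γ ⊗ y)`, and is sent to `f = T ∘ δ`. This map is holomorphic because `δ` is:
Cauchy's estimates bound Taylor remainders uniformly on the unit ball of `H^∞(U)`. The
correspondence is injective because the `δ(x)` span a dense subspace of `G^∞(U)`.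

The inequality `d_p(f) ≤ ‖φ‖` (`norm_mem_cohenConstants`) would be the definition of `g_p` if the
test functionals came from `F`, but for values in `F*` they range over `F**`. The passage to `F**`
is `norm_sum_bidual_le`. A finite net of the dual ball of `ℓ_q^n` describes the weak norm on `F^n`,
up to a factor close to 1, as a finite maximum of the norms of linear combinations `∑ cᵢ yᵢ`. By
Hahn–Banach, a functional bounded by such a maximum is a combination of finitely many functionals on
`F` with controlled total norm, and this formula makes sense on `F**` with the same bound.

Conversely, given `f`, every `f(·)(y)` lies in `H^∞(U)`, so `γ` in `G^∞(U)` acts on it directly.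
Since `|γ(f(·)(y))| ≤ ‖γ‖ sup_x |f(x)(y)|`, points almost attaining the suprema and the Cohen
inequality with `λᵢ = ‖γᵢ‖` bound this bilinear form by `d_p(f)` (`norm_sum_pairing_le`). It
therefore defines a functional of norm at most `d_p(f)` that is sent to `f`. With injectivity this
gives surjectivity and the isometry. -/

/-- The extension by zero of a function on `U` to the whole space. -/
def zeroExtend (f : U → F) : E → F := Function.extend Subtype.val f 0

theorem zeroExtend_apply (f : U → F) (x : U) : zeroExtend f x = f x :=
  Subtype.val_injective.extend_apply f 0 x

theorem zeroExtend_of_notMem (f : U → F) {x : E} (hx : x ∉ U) : zeroExtend f x = 0 :=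
  Function.extend_apply' (f := Subtype.val) f (0 : E → F) x fun ⟨a, ha⟩ => hx (ha ▸ a.2)

end ZeroExtend

variable {E : Type u} [NormedAddCommGroup E] [NormedSpace ℂ E]
  {F : Type v} [NormedAddCommGroup F] [NormedSpace ℂ F] {U : TopologicalSpace.Opens E}

/-- As `U` is open, the inclusion carries the neighbourhood filter of `a` in `U` to that of `a` in
`E`, so the values off `U` play no role. -/
theorem hasFDerivAt_zeroExtend_iff {f : U → F} {a : U} {T : E →L[ℂ] F} :
    HasFDerivAt (zeroExtend f) T a ↔
      (fun x : U => f x - f a - T ((x : E) - (a : E))) =o[nhds a] fun x : U => (x : E) - (a : E) := by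
  rw [hasFDerivAt_iff_isLittleO, ← U.isOpen.isOpenEmbedding_subtypeVal.map_nhds_eq a,
    Asymptotics.isLittleO_map]
  simp only [Function.comp_def, zeroExtend_apply]
  rfl

theorem IsHolomorphic.differentiableAt_zeroExtend {f : U → F} (hf : IsHolomorphic U f) (a : U) :
    DifferentiableAt ℂ (zeroExtend f) a :=
  let ⟨T, hT⟩ := hf a
  ⟨T, hasFDerivAt_zeroExtend_iff.2 hT⟩

theorem IsHolomorphic.continuous {f : U → F} (hf : IsHolomorphic U f) : Continuous f := by
  refine continuous_iff_continuousAt.2 fun a => ?_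
  have h := (hf.differentiableAt_zeroExtend a).continuousAt.comp
    (f := Subtype.val) continuous_subtype_val.continuousAt
  simpa only [Function.comp_def, zeroExtend_apply] using h

theorem IsHolomorphic.clm_comp {G : Type*} [NormedAddCommGroup G] [NormedSpace ℂ G] {f : U → F}
    (hf : IsHolomorphic U f) (L : F →L[ℂ] G) : IsHolomorphic U fun x => L (f x) := fun a => by
  obtain ⟨T, hT⟩ := hf a
  refine ⟨L.comp T, ((L.isBigO_comp _ _).trans_isLittleO hT).congr_left fun x => ?_⟩
  simp

theorem HInf.norm_apply_le (h : HInf U) (x : U) : ‖h x‖ ≤ ‖h‖ := h.1.norm_coe_le_norm x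

theorem HInf.norm_le {h : HInf U} {C : ℝ} (hC : 0 ≤ C) (H : ∀ x, ‖h x‖ ≤ C) : ‖h‖ ≤ C :=
  (BoundedContinuousFunction.norm_le hC).2 H

theorem HInf.zeroExtend_add (g h : HInf U) :
    zeroExtend (g + h : HInf U) = zeroExtend g + zeroExtend h := by
  ext x
  by_cases hx : x ∈ U
  · lift x to U using hx
    simp only [Pi.add_apply, zeroExtend_apply]
    rfl
  · simp [zeroExtend_of_notMem _ hx]

theorem HInf.zeroExtend_smul (c : ℂ) (h : HInf U) :
    zeroExtend (c • h : HInf U) = c • zeroExtend h := by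
  ext x
  by_cases hx : x ∈ U
  · lift x to U using hx
    simp only [Pi.smul_apply, zeroExtend_apply]
    rfl
  · simp [zeroExtend_of_notMem _ hx]

/-! ### Cauchy estimates and the derivative of `δ` -/

variable {a : U} {R : ℝ}

theorem HInf.differentiableOn_zeroExtend (hU : Metric.ball (a : E) R ⊆ U) (h : HInf U) :
    DifferentiableOn ℂ (zeroExtend h) (Metric.ball (a : E) R) := fun x hx =>
  (IsHolomorphic.differentiableAt_zeroExtend h.2 ⟨x, hU hx⟩).differentiableWithinAt

theorem HInf.norm_zeroExtend_sub_le (h : HInf U) (x y : U) :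
    ‖zeroExtend h x - zeroExtend h y‖ ≤ 2 * ‖h‖ := by
  rw [zeroExtend_apply, zeroExtend_apply, two_mul]
  exact (norm_sub_le _ _).trans (add_le_add (h.norm_apply_le x) (h.norm_apply_le y))

/-- Cauchy's estimate for the first derivative. -/
theorem HInf.norm_fderiv_zeroExtend_le (hR : 0 < R) (hU : Metric.ball (a : E) R ⊆ U) (h : HInf U) :
    ‖fderiv ℂ (zeroExtend h) a‖ ≤ 2 * ‖h‖ / R := by
  refine Complex.norm_fderiv_le_div_of_mapsTo_ball (h.differentiableOn_zeroExtend hU)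
    (fun x hx => ?_) hR
  rw [mem_closedBall_iff_norm]
  exact h.norm_zeroExtend_sub_le ⟨x, hU hx⟩ a

/-- The remainder of the first order Taylor expansion, uniformly on balls of `H^∞(U)`. -/
theorem HInf.norm_zeroExtend_sub_sub_fderiv_le (hR : 0 < R) (hU : Metric.ball (a : E) R ⊆ U)
    (h : HInf U) {x : E} (hx : x ∈ Metric.ball (a : E) R) :
    ‖zeroExtend h x - zeroExtend h a - fderiv ℂ (zeroExtend h) a (x - a)‖ ≤
      4 * ‖h‖ * (‖x - a‖ / R) ^ 2 := by
  set T := fderiv ℂ (zeroExtend h) (a : E) with hT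
  have hder : HasFDerivAt (zeroExtend h) T a :=
    (IsHolomorphic.differentiableAt_zeroExtend h.2 a).hasFDerivAt
  -- Schwarz lemma of order two: the remainder is `o(‖x - a‖)` (`n = 1`) and is bounded by `4‖h‖` on
  -- the ball, `2‖h‖` for the increment of `h` and `2‖h‖` for the linear term.
  have key := Complex.dist_le_mul_div_pow_of_mapsTo_ball_of_isLittleO
    (f := fun x => zeroExtend h x - zeroExtend h a - T (x - a)) (c := (a : E)) (z := x) (R₁ := R)
    (R₂ := 4 * ‖h‖) (n := 1) ?_ ?_ ?_ hx
  · simpa [dist_eq_norm] using key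
  · exact ((h.differentiableOn_zeroExtend hU).sub_const _).sub
      (T.differentiable.comp (differentiable_id.sub_const _)).differentiableOn
  · intro y hy
    rw [mem_closedBall_iff_norm]
    simp only [sub_self, map_zero, sub_zero]
    have h1 := h.norm_zeroExtend_sub_le ⟨y, hU hy⟩ a
    have h2 : ‖T (y - a)‖ ≤ 2 * ‖h‖ := by
      refine (T.le_of_opNorm_le (h.norm_fderiv_zeroExtend_le hR hU) _).trans ?_
      rw [div_mul_eq_mul_div, div_le_iff₀ hR]
      gcongr
      exact (mem_ball_iff_norm.1 hy).le
    refine (norm_sub_le _ _).trans ?_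
    linarith
  · simpa using (hasFDerivAt_iff_isLittleO.1 hder).norm_right

theorem zeroExtend_evalFunctional_apply (x : E) (h : HInf U) :
    zeroExtend (evalFunctional U) x h = zeroExtend h x := by
  by_cases hx : x ∈ U
  · lift x to U using hx
    rw [zeroExtend_apply, zeroExtend_apply, evalFunctional_apply]
  · rw [zeroExtend_of_notMem _ hx, zeroExtend_of_notMem _ hx]
    rfl

theorem zeroExtend_evalFunctional_mem (x : E) : zeroExtend (evalFunctional U) x ∈ GInf U := by
  by_cases hx : x ∈ U
  · lift x to U using hx
    rw [zeroExtend_apply]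
    exact (delta U x).2
  · rw [zeroExtend_of_notMem _ hx]
    exact zero_mem _

/-- The derivative sends `v` to the functional `h ↦ dh(a)v`, of norm at most `(2/R)‖v‖` by Cauchy.
The quadratic remainder bound is linear in `‖h‖`, so it is a bound in the norm of `H^∞(U)*`. -/
theorem exists_hasFDerivAt_evalFunctional (a : U) :
    ∃ T : E →L[ℂ] StrongDual ℂ (HInf U), HasFDerivAt (zeroExtend (evalFunctional U)) T a := by
  obtain ⟨R, hR, hU⟩ := Metric.isOpen_iff.1 U.isOpen a a.2
  have hd : ∀ h : HInf U, DifferentiableAt ℂ (zeroExtend h) a := fun h =>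
    IsHolomorphic.differentiableAt_zeroExtend h.2 a
  let D : E →ₗ[ℂ] HInf U →ₗ[ℂ] ℂ :=
    LinearMap.mk₂ ℂ (fun v h => fderiv ℂ (zeroExtend h) a v) (fun v w h => map_add _ v w)
      (fun c v h => map_smul _ c v)
      (fun v g h => by rw [HInf.zeroExtend_add, fderiv_add (hd g) (hd h)]; rfl)
      (fun c v h => by rw [HInf.zeroExtend_smul, fderiv_const_smul (hd h)]; rfl)
  let T : E →L[ℂ] StrongDual ℂ (HInf U) := D.mkContinuous₂ (2 / R) fun v h =>
    (ContinuousLinearMap.le_of_opNorm_le _ (h.norm_fderiv_zeroExtend_le hR hU) v).trans_eq (by ring)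
  refine ⟨T, hasFDerivAt_iff_isLittleO.2 ?_⟩
  refine Asymptotics.IsBigO.trans_isLittleO ?_ (Asymptotics.isLittleO_pow_sub_sub (a : E) one_lt_two)
  refine Asymptotics.IsBigO.of_bound (4 / R ^ 2) ?_
  filter_upwards [Metric.ball_mem_nhds (a : E) hR] with x hx
  refine ContinuousLinearMap.opNorm_le_bound _ (by positivity) fun h => ?_
  have := h.norm_zeroExtend_sub_sub_fderiv_le hR hU hx
  simp only [sub_apply, zeroExtend_evalFunctional_apply]
  refine this.trans_eq ?_
  rw [norm_pow, norm_norm]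
  ring

theorem isHolomorphic_delta : IsHolomorphic U (delta U) := fun a => by
  obtain ⟨T, hT⟩ := exists_hasFDerivAt_evalFunctional a
  have hmem : ∀ v, T v ∈ GInf U := fun v => by
    -- `T v` is the limit of `n (δ(a + v/n) - δ(a))`, and `G^∞(U)` is closed. For small `n` the
    -- point may leave `U`, where the extension is `0` and still lies in `G^∞(U)`.
    have hlim := hT.lim v (c := fun n : ℕ => (n : ℂ)) (l := Filter.atTop)
      (by simpa using tendsto_natCast_atTop_atTop)
    refine (Submodule.isClosed_topologicalClosure _).mem_of_tendsto hlim (.of_forall fun n => ?_)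
    exact (GInf U).smul_mem _
      (sub_mem (zeroExtend_evalFunctional_mem _) (zeroExtend_evalFunctional_mem _))
  refine ⟨T.codRestrict (GInf U) hmem, ?_⟩
  exact Asymptotics.IsLittleO.of_norm_left (hasFDerivAt_zeroExtend_iff.1 hT).norm_left

theorem norm_delta_le (x : U) : ‖delta U x‖ ≤ 1 :=
  ContinuousLinearMap.opNorm_le_bound _ zero_le_one fun h => by
    rw [one_mul]; exact h.norm_apply_le x

/-- A bounded holomorphic function, as an element of `H^∞(U)`. -/
def HInf.ofBound (f : U → ℂ) (hf : IsHolomorphic U f) (C : ℝ) (hC : ∀ x, ‖f x‖ ≤ C) : HInf U :=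
  ⟨BoundedContinuousFunction.ofNormedAddCommGroup f hf.continuous C hC, hf⟩

end Holomorphic

/-! ### Finite families in the bidual -/

section Bidual

variable {F : Type u} [NormedAddCommGroup F] [NormedSpace ℂ F]

/-- The value of a functional on `ℓ_q^n` on the family of scalars `φ(yᵢ)`. -/
theorem clm_piLp_apply_toLp (q : ℝ≥0∞) {n : ℕ} (c : StrongDual ℂ (PiLp q fun _ : Fin n => ℂ))
    (φ : StrongDual ℂ F) (y : Fin n → F) :
    c (WithLp.toLp q fun i => φ (y i)) =
      φ (∑ i, c (WithLp.toLp q (Pi.single i 1)) • y i) := by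
  have h : (WithLp.toLp q (fun i => φ (y i)) : PiLp q fun _ : Fin n => ℂ) =
      ∑ i, φ (y i) • WithLp.toLp q (Pi.single i (1 : ℂ)) := by
    ext j
    simp [Pi.single_apply]
  rw [h, map_sum, map_sum]
  refine Finset.sum_congr rfl fun i _ => ?_
  rw [map_smul, map_smul, smul_eq_mul, smul_eq_mul, mul_comm]

variable (q : ℝ≥0∞) [Fact (1 ≤ q)]

/-- The embedding into the bidual does not increase weak norms. -/
theorem weakNorm_inclusionInDoubleDual_le {n : ℕ} (y : Fin n → F) :
    weakNorm q (fun i => NormedSpace.inclusionInDoubleDual ℂ F (y i)) ≤ weakNorm q y := by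
  refine Real.iSup_le (fun ψ => ?_) (weakNorm_nonneg q y)
  refine le_weakNorm q y (φ := ψ.1.comp (NormedSpace.inclusionInDoubleDual ℂ F)) ?_
  refine (ContinuousLinearMap.opNorm_comp_le _ _).trans ?_
  exact mul_le_one₀ (mem_closedBall_zero_iff.1 ψ.2) (norm_nonneg _)
    (NormedSpace.inclusionInDoubleDual_norm_le ℂ F)

/-- The unit ball of the dual of a finite-dimensional space has finite subsets that almost norm the
space. -/
theorem exists_finset_almost_norming {V : Type*} [NormedAddCommGroup V] [NormedSpace ℂ V]
    [FiniteDimensional ℂ V] {ε : ℝ} (hε : 0 < ε) :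
    ∃ S : Finset (StrongDual ℂ V), (∀ c ∈ S, ‖c‖ ≤ 1) ∧
      ∀ b : V, ∃ c ∈ S, (1 - ε) * ‖b‖ ≤ ‖c b‖ := by
  have : ProperSpace (StrongDual ℂ V) := FiniteDimensional.proper ℂ _
  obtain ⟨t, ht, hfin, hcov⟩ :=
    (isCompact_closedBall (0 : StrongDual ℂ V) 1).finite_cover_balls hε
  refine ⟨hfin.toFinset, fun c hc => mem_closedBall_zero_iff.1 (ht (hfin.mem_toFinset.1 hc)),
    fun b => ?_⟩
  obtain ⟨d, hd, hdb⟩ := exists_dual_vector'' ℂ b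
  obtain ⟨c, hc, hdc⟩ := Set.mem_iUnion₂.1 (hcov (mem_closedBall_zero_iff.2 hd))
  refine ⟨c, hfin.mem_toFinset.2 hc, ?_⟩
  have h1 : ‖(d - c) b‖ ≤ ε * ‖b‖ :=
    (d - c).le_of_opNorm_le (mem_ball_iff_norm.1 hdc).le b
  have h2 : ‖d b‖ = ‖b‖ := by simp [hdb]
  have h3 : ‖d b‖ ≤ ‖(d - c) b‖ + ‖c b‖ := by
    simpa using norm_add_le ((d - c) b) (c b)
  linarith

/-- A norming functional `φ` turns the combination into `c` applied to the scalar family `φ(yᵢ)`. It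
is used for families in the bidual. -/
theorem norm_sum_smul_le_weakNorm {n : ℕ} {c : StrongDual ℂ (PiLp q fun _ : Fin n => ℂ)}
    (hc : ‖c‖ ≤ 1) (y : Fin n → F) :
    ‖∑ i, c (WithLp.toLp q (Pi.single i 1)) • y i‖ ≤ weakNorm q y := by
  obtain ⟨φ, hφ, h⟩ := exists_dual_vector'' ℂ (∑ i, c (WithLp.toLp q (Pi.single i 1)) • y i)
  rw [← clm_piLp_apply_toLp] at h
  have h1 := c.le_of_opNorm_le hc (WithLp.toLp q fun i => φ (y i))
  rw [h, one_mul] at h1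
  simpa using h1.trans (le_weakNorm q y hφ)

/-- A linear functional dominated by the sup norm of a linear map into a finite product factors
through that map, with control of the norm. -/
theorem exists_factor_of_norm_le {X : Type*} [AddCommGroup X] [Module ℂ X] {K : Type*} [Fintype K]
    (J : X →ₗ[ℂ] K → F) (G : X →ₗ[ℂ] ℂ) {A : ℝ} (hA : 0 ≤ A) (h : ∀ x, ‖G x‖ ≤ A * ‖J x‖) :
    ∃ H : StrongDual ℂ (K → F), ‖H‖ ≤ A ∧ ∀ x, G x = H (J x) := by
  -- A linear section `s` of `J` onto its range transports `G` to the range with the bound `A`;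
  -- Hahn–Banach then extends it.
  obtain ⟨s, hs⟩ := J.rangeRestrict.exists_rightInverse_of_surjective J.range_rangeRestrict
  have hs' : ∀ r : LinearMap.range J, J (s r) = r := fun r =>
    congrArg Subtype.val (LinearMap.congr_fun hs r)
  obtain ⟨H, hH, hn⟩ := exists_extension_norm_eq (LinearMap.range J)
    ((G ∘ₗ s).mkContinuous A fun r => by
      simpa [hs'] using h (s r))
  refine ⟨H, hn.trans_le (LinearMap.mkContinuous_norm_le _ hA _), fun x => ?_⟩
  have h1 : H (J x) = G (s (J.rangeRestrict x)) := hH (J.rangeRestrict x)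
  -- This vector lies in the kernel of `J`, so the domination makes `G` vanish on it.
  have h2 := h (x - s (J.rangeRestrict x))
  rw [map_sub, map_sub, hs'] at h2
  rw [h1]
  simpa [sub_eq_zero] using h2

/-- The coordinates of a functional on a finite product with the sup norm. -/
theorem sum_norm_comp_single_le {K : Type*} [Fintype K] [DecidableEq K]
    (H : StrongDual ℂ (K → F)) :
    ∑ k, ‖H.comp (ContinuousLinearMap.single ℂ (fun _ : K => F) k)‖ ≤ ‖H‖ := by
  set h : K → StrongDual ℂ F := fun k => H.comp (ContinuousLinearMap.single ℂ (fun _ => F) k)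
    with hh
  refine le_of_forall_pos_le_add fun ε hε => ?_
  -- The total error over `K` stays below `ε`; the `+ 1` covers empty `K`.
  have hδ : 0 < ε / (Fintype.card K + 1) := by positivity
  have hx : ∀ k, ∃ x : F, ‖x‖ ≤ 1 ∧ h k x = ‖h k x‖ ∧
      ‖h k‖ - ε / (Fintype.card K + 1) ≤ ‖h k x‖ := fun k => by
    obtain ⟨x, hx, hlt⟩ := (h k).exists_lt_apply_of_lt_opNorm (sub_lt_self ‖h k‖ hδ)
    -- Rotating by a unimodular scalar makes each value a nonnegative real, so the values add up
    -- without cancellation at one point of the sup-norm unit ball.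
    obtain ⟨c, hc, hcx⟩ := RCLike.exists_norm_eq_mul_self (h k x)
    refine ⟨c • x, by rw [norm_smul, hc, one_mul]; exact hx.le, ?_, ?_⟩
    · rw [map_smul, norm_smul, hc, one_mul, smul_eq_mul]; exact hcx.symm
    · rw [map_smul, norm_smul, hc, one_mul]; exact hlt.le
  choose x hx1 hx2 hx3 using hx
  have hsum : H x = ((∑ k, ‖h k (x k)‖ : ℝ) : ℂ) := by
    push_cast
    simp_rw [← hx2]
    conv_lhs => rw [← Finset.univ_sum_single x]
    rw [map_sum]
    rfl
  have hle : ∑ k, ‖h k (x k)‖ ≤ ‖H‖ := by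
    have h1 := H.le_opNorm_of_le ((pi_norm_le_iff_of_nonneg zero_le_one).2 hx1)
    rw [hsum, Complex.norm_real, mul_one] at h1
    exact (le_abs_self _).trans h1
  calc ∑ k, ‖h k‖ ≤ ∑ k, (‖h k (x k)‖ + ε / (Fintype.card K + 1)) :=
        Finset.sum_le_sum fun k _ => by linarith [hx3 k]
    _ = ∑ k, ‖h k (x k)‖ + Fintype.card K * (ε / (Fintype.card K + 1)) := by
        rw [Finset.sum_add_distrib, Finset.sum_const, Finset.card_univ, nsmul_eq_mul]
    _ ≤ ‖H‖ + ε := by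
        gcongr
        rw [mul_div_assoc', div_le_iff₀ (by positivity)]
        nlinarith

/-- A bound of a finite family of functionals against the weak norm of families in `F` persists for
families in the bidual: a weak form of local reflexivity. -/
theorem norm_sum_bidual_le {n : ℕ} (g : Fin n → StrongDual ℂ F) {A : ℝ} (hA : 0 ≤ A)
    (hg : ∀ y : Fin n → F, ‖∑ i, g i (y i)‖ ≤ A * weakNorm q y)
    (z : Fin n → StrongDual ℂ (StrongDual ℂ F)) :
    ‖∑ i, z i (g i)‖ ≤ A * weakNorm q z := by
  classical
  -- A finite net only norms `ℓ_q^n` up to a factor `t < 1`; the factor disappears as `t → 1`.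
  suffices H : ∀ t : ℝ, 0 < t → t < 1 → t * ‖∑ i, z i (g i)‖ ≤ A * weakNorm q z by
    have hlim : Filter.Tendsto (fun t : ℝ => t * ‖∑ i, z i (g i)‖) (nhdsWithin 1 (Set.Iio 1))
        (nhds (1 * ‖∑ i, z i (g i)‖)) :=
      (Filter.tendsto_id.mul_const _).mono_left nhdsWithin_le_nhds
    rw [one_mul] at hlim
    refine le_of_tendsto hlim ?_
    filter_upwards [Ioo_mem_nhdsLT (zero_lt_one' ℝ)] with t ht using H t ht.1 ht.2
  intro t h0 h1
  obtain ⟨S, hS1, hS2⟩ := exists_finset_almost_norming (V := PiLp q fun _ : Fin n => ℂ)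
    (sub_pos.2 h1)
  rw [sub_sub_cancel] at hS2
  let e : Fin n → PiLp q fun _ : Fin n => ℂ := fun i => WithLp.toLp q (Pi.single i 1)
  -- The coordinates of `J y` are the combinations `∑ c(eᵢ) yᵢ` with `c` in the net, so the sup norm
  -- of `J y` dominates `t` times the weak norm of `y`.
  let J : (Fin n → F) →ₗ[ℂ] S → F :=
    LinearMap.pi fun c => ∑ i, c.1 (e i) • LinearMap.proj i
  have hJ : ∀ y c, J y c = ∑ i, c.1 (e i) • y i := fun y c => by simp [J]
  have hwJ : ∀ y, t * weakNorm q y ≤ ‖J y‖ := fun y => by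
    rw [weakNorm, Real.mul_iSup_of_nonneg h0.le]
    refine Real.iSup_le (fun φ => ?_) (norm_nonneg _)
    obtain ⟨c, hc, hcb⟩ := hS2 (WithLp.toLp q fun i => φ.1 (y i))
    refine hcb.trans ?_
    rw [clm_piLp_apply_toLp]
    refine (φ.1.le_of_opNorm_le (mem_closedBall_zero_iff.1 φ.2) _).trans ?_
    rw [one_mul]
    exact (hJ y ⟨c, hc⟩).symm ▸ norm_le_pi_norm (J y) ⟨c, hc⟩
  let G : (Fin n → F) →ₗ[ℂ] ℂ := ∑ i, (g i).toLinearMap ∘ₗ LinearMap.proj i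
  have hG : ∀ y, G y = ∑ i, g i (y i) := fun y => by simp [G]
  obtain ⟨H, hH, hGH⟩ := exists_factor_of_norm_le J G (div_nonneg hA h0.le) fun y => by
    rw [hG, div_mul_eq_mul_div, le_div_iff₀ h0]
    calc ‖∑ i, g i (y i)‖ * t ≤ A * weakNorm q y * t := by gcongr; exact hg y
      _ = A * (t * weakNorm q y) := by ring
      _ ≤ A * ‖J y‖ := by gcongr; exact hwJ y
  set h : S → StrongDual ℂ F := fun k => H.comp (ContinuousLinearMap.single ℂ (fun _ => F) k)
    with hh
  -- Evaluating `G = H ∘ J` on families supported at `i` expresses `g i` through the coordinates of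
  -- `H`. This identity between elements of `F*` can be tested against `F**`.
  have hgi : ∀ i, g i = ∑ c : S, c.1 (e i) • h c := fun i => by
    ext v
    have h2 : g i v = G (Pi.single i v) := by
      rw [hG, Finset.sum_eq_single i]
      · simp
      · intro j _ hj; simp [Pi.single_eq_of_ne hj]
      · simp
    rw [h2, hGH, ← Finset.univ_sum_single (J (Pi.single i v)), map_sum]
    simp only [sum_apply, smul_apply, ← map_smul]
    refine Finset.sum_congr rfl fun c _ => ?_
    have h3 : J (Pi.single i v) c = c.1 (e i) • v := by
      rw [hJ, Finset.sum_eq_single i]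
      · simp
      · intro j _ hj; simp [Pi.single_eq_of_ne hj]
      · simp
    rw [h3]
    rfl
  have hz : ∑ i, z i (g i) = ∑ c : S, (∑ i, c.1 (e i) • z i) (h c) := by
    simp only [hgi, map_sum, map_smul, sum_apply,
      smul_apply]
    exact Finset.sum_comm
  have hw := weakNorm_nonneg q z
  have hfin : ‖∑ i, z i (g i)‖ ≤ A / t * weakNorm q z := by
    rw [hz]
    calc ‖∑ c : S, (∑ i, c.1 (e i) • z i) (h c)‖ ≤ ∑ c : S, weakNorm q z * ‖h c‖ :=
          norm_sum_le_of_le _ fun c _ => ContinuousLinearMap.le_of_opNorm_le _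
            (norm_sum_smul_le_weakNorm q (hS1 c.1 c.2) z) _
      _ ≤ weakNorm q z * (A / t) := by
          rw [← Finset.mul_sum]
          gcongr
          exact (sum_norm_comp_single_le H).trans hH
      _ = _ := mul_comm _ _
  rwa [div_mul_eq_mul_div, le_div_iff₀ h0, mul_comm] at hfin

end Bidual

/-! ### The duality -/

/-! ### Norms of one-term and rescaled families -/

section Families

variable {F : Type u} [NormedAddCommGroup F] (p : ℝ≥0∞) [Fact (1 ≤ p)]

theorem strongNorm_const_fin_one (x : F) : strongNorm p (fun _ : Fin 1 => x) = ‖x‖ := by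
  by_cases ht : p = ∞
  · subst ht
    rw [strongNorm_top, ciSup_const]
  · have h0 : p.toReal ≠ 0 :=
      (ENNReal.toReal_pos (zero_lt_one.trans_le Fact.out).ne' ht).ne'
    rw [strongNorm_eq_sum Fact.out ht, Fin.sum_univ_one, one_div,
      Real.rpow_rpow_inv (norm_nonneg _) h0]

theorem strongNorm_smul_le [NormedSpace ℂ F] {n : ℕ} {a b : Fin n → ℂ} {x : Fin n → F}
    (hab : ∀ i, ‖a i‖ ≤ ‖b i‖) (hx : ∀ i, ‖x i‖ ≤ 1) :
    strongNorm p (fun i => a i • x i) ≤ strongNorm p b :=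
  strongNorm_mono p fun i => by
    rw [norm_smul]
    exact (mul_le_of_le_one_right (norm_nonneg _) (hx i)).trans (hab i)

theorem weakNorm_const_fin_one_le [NormedSpace ℂ F] (x : F) :
    weakNorm p (fun _ : Fin 1 => x) ≤ ‖x‖ := by
  refine Real.iSup_le (fun φ => ?_) (norm_nonneg _)
  rw [strongNorm_const_fin_one]
  simpa using φ.1.le_of_opNorm_le (mem_closedBall_zero_iff.1 φ.2) x

end Families

/-! ### Functionals on the completed tensor product as operators and bilinear forms -/

section CTmul

variable (p : ℝ≥0∞) [Fact (1 ≤ p)] {E : Type u} {F : Type v} [NormedAddCommGroup E]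
  [NormedSpace ℂ E] [NormedAddCommGroup F] [NormedSpace ℂ F]

theorem norm_ctmul_le (x : E) (y : F) : ‖ctmul p x y‖ ≤ ‖x‖ * ‖y‖ := by
  have h := ChevetSaphar.norm_le p (fun _ : Fin 1 => x) fun _ => y
  rw [Fin.sum_univ_one, strongNorm_const_fin_one] at h
  rw [ctmul, UniformSpace.Completion.norm_coe]
  exact h.trans (mul_le_mul_of_nonneg_left (weakNorm_const_fin_one_le _ y) (norm_nonneg x))

theorem norm_sum_ctmul_le {n : ℕ} (x : Fin n → E) (y : Fin n → F) :
    ‖∑ i, ctmul p (x i) (y i)‖ ≤ strongNorm p x * weakNorm (conjIndex p) y := by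
  have h : ∑ i, ctmul p (x i) (y i) =
      ((∑ i, ChevetSaphar.tmul p (x i) (y i) : ChevetSaphar p E F) :
        CompletedChevetSaphar p E F) :=
    (map_sum (UniformSpace.Completion.toComplL (𝕜 := ℂ) (E := ChevetSaphar p E F)) _ _).symm
  rw [h, UniformSpace.Completion.norm_coe]
  exact ChevetSaphar.norm_le p x y

theorem ctmul_add_left (x x' : E) (y : F) : ctmul p (x + x') y = ctmul p x y + ctmul p x' y := by
  rw [ctmul, ctmul, ctmul, ← UniformSpace.Completion.coe_add]
  exact congrArg _ (TensorProduct.add_tmul x x' y)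

theorem ctmul_add_right (x : E) (y y' : F) : ctmul p x (y + y') = ctmul p x y + ctmul p x y' := by
  rw [ctmul, ctmul, ctmul, ← UniformSpace.Completion.coe_add]
  exact congrArg _ (TensorProduct.tmul_add x y y')

theorem ctmul_smul_left (c : ℂ) (x : E) (y : F) : ctmul p (c • x) y = c • ctmul p x y := by
  rw [ctmul, ChevetSaphar.smul_tmul, UniformSpace.Completion.coe_smul, ctmul]

theorem ctmul_smul_right (c : ℂ) (x : E) (y : F) : ctmul p x (c • y) = c • ctmul p x y := by
  rw [ctmul, ChevetSaphar.tmul_smul, UniformSpace.Completion.coe_smul, ctmul]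

variable (E F) in
/-- The bounded bilinear map `(x, y) ↦ x ⊗ y`. -/
def ctmulCLM : E →L[ℂ] F →L[ℂ] CompletedChevetSaphar p E F :=
  LinearMap.mkContinuous₂
    (LinearMap.mk₂ ℂ (ctmul p) (ctmul_add_left p) (ctmul_smul_left p) (ctmul_add_right p)
      (ctmul_smul_right p)) 1 fun x y => by
    rw [one_mul]; exact norm_ctmul_le p x y

/-- The bounded operator `E → F*` associated with a functional on the completed tensor product. -/
def dualToOperator (φ : StrongDual ℂ (CompletedChevetSaphar p E F)) : E →L[ℂ] StrongDual ℂ F :=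
  (ContinuousLinearMap.compL ℂ F (CompletedChevetSaphar p E F) ℂ φ).comp (ctmulCLM p E F)

theorem dualToOperator_apply (φ : StrongDual ℂ (CompletedChevetSaphar p E F)) (x : E) (y : F) :
    dualToOperator p φ x y = φ (ctmul p x y) := rfl

theorem dual_eq_zero_of_ctmul {φ : StrongDual ℂ (CompletedChevetSaphar p E F)}
    (h : ∀ x y, φ (ctmul p x y) = 0) : φ = 0 := by
  ext w
  refine UniformSpace.Completion.induction_on w
    (isClosed_eq φ.continuous continuous_const) fun w => ?_
  obtain ⟨n, x, y, rfl⟩ := ChevetSaphar.exists_rep p w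
  have : ((∑ i, ChevetSaphar.tmul p (x i) (y i) : ChevetSaphar p E F) :
        CompletedChevetSaphar p E F) = ∑ i, ctmul p (x i) (y i) :=
    map_sum (UniformSpace.Completion.toComplL (𝕜 := ℂ) (E := ChevetSaphar p E F)) _ _
  rw [this, map_sum]
  exact Finset.sum_eq_zero fun i _ => h _ _

/-- A bilinear form bounded on all representations defines a functional on the completed tensor
product. -/
theorem exists_dual_of_bilinear (B : E →ₗ[ℂ] F →ₗ[ℂ] ℂ) {C : ℝ} (hC : 0 ≤ C)
    (h : ∀ (n : ℕ) (x : Fin n → E) (y : Fin n → F),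
      ‖∑ i, B (x i) (y i)‖ ≤ C * (strongNorm p x * weakNorm (conjIndex p) y)) :
    ∃ φ : StrongDual ℂ (CompletedChevetSaphar p E F), ‖φ‖ ≤ C ∧
      ∀ x y, φ (ctmul p x y) = B x y := by
  let L : ChevetSaphar p E F →ₗ[ℂ] ℂ := TensorProduct.lift B
  have hL : ∀ x y, L (ChevetSaphar.tmul p x y) = B x y := fun x y => TensorProduct.lift.tmul x y
  let L' : ChevetSaphar p E F →L[ℂ] ℂ := L.mkContinuous C fun w => by
    rw [ChevetSaphar.norm_def p w, ← smul_eq_mul, ← Real.sInf_smul_of_nonneg hC]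
    refine le_csInf ((ChevetSaphar.values_nonempty p w).smul_set) ?_
    rintro _ ⟨_, ⟨n, x, y, rfl, rfl⟩, rfl⟩
    simp only [map_sum, hL]
    exact h n x y
  have hn : ‖L'‖ ≤ C := L.mkContinuous_norm_le hC _
  let e : ChevetSaphar p E F →L[ℂ] CompletedChevetSaphar p E F :=
    UniformSpace.Completion.toComplL
  have he : DenseRange e := UniformSpace.Completion.denseRange_coe
  refine ⟨L'.extend e, ?_, fun x y => ?_⟩
  · refine (L'.opNorm_extend_le (N := 1) he fun w => ?_).trans ?_
    · rw [NNReal.coe_one, one_mul]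
      exact (UniformSpace.Completion.norm_coe w).ge
    · rwa [NNReal.coe_one, one_mul]
  · exact (L'.extend_eq he (UniformSpace.Completion.isUniformInducing_coe _) _).trans (hL x y)

end CTmul

/-! ### From functionals to Cohen summing maps -/

section Duality

variable (p : ℝ≥0∞) [Fact (1 ≤ p)] {E : Type u} [NormedAddCommGroup E]
  [NormedSpace ℂ E] {F : Type v} [NormedAddCommGroup F] [NormedSpace ℂ F]
  {U : TopologicalSpace.Opens E}

/-- The set where `S` and `T` agree, viewed inside `H^∞(U)*`, is a closed subspace because `G^∞(U)`
is closed there; it contains every `δ(x)`. -/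
theorem GInf.clm_ext {G : Type*} [NormedAddCommGroup G] [NormedSpace ℂ G] {S T : GInf U →L[ℂ] G}
    (h : ∀ x, S (delta U x) = T (delta U x)) : S = T := by
  let K := (LinearMap.eqLocus S.toLinearMap T.toLinearMap).map (GInf U).subtype
  have hK : IsClosed (K : Set (StrongDual ℂ (HInf U))) :=
    (Submodule.isClosed_topologicalClosure _).isClosedEmbedding_subtypeVal.isClosedMap _
      (isClosed_eq S.continuous T.continuous)
  have hle : GInf U ≤ K := by
    refine Submodule.topologicalClosure_minimal _ (Submodule.span_le.2 ?_) hK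
    rintro _ ⟨x, rfl⟩
    exact ⟨delta U x, h x, rfl⟩
  ext1 γ
  obtain ⟨γ', h', hγ⟩ := hle γ.2
  rwa [← Subtype.ext hγ]

/-- The moduli `|λᵢ|` and the phases of the summands are absorbed into functionals `gᵢ = |λᵢ| cᵢ
f(xᵢ)` on `F`, turning the Cohen sum into `|∑ zᵢ(gᵢ)|` with `zᵢ` in `F**`. -/
theorem norm_mem_cohenConstants (φ : StrongDual ℂ (CompletedChevetSaphar p (GInf U) F)) :
    ‖φ‖ ∈ cohenConstants p U fun x => dualToOperator p φ (delta U x) := by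
  refine ⟨norm_nonneg φ, fun n l x z => ?_⟩
  choose c hc hcz using fun i =>
    RCLike.exists_norm_eq_mul_self (z i (dualToOperator p φ (delta U (x i))))
  have h1 : ∑ i, ‖l i‖ * ‖z i (dualToOperator p φ (delta U (x i)))‖ =
      ‖∑ i, z i (((‖l i‖ : ℂ) * c i) • dualToOperator p φ (delta U (x i)))‖ := by
    have : ∑ i, z i (((‖l i‖ : ℂ) * c i) • dualToOperator p φ (delta U (x i))) =
        ((∑ i, ‖l i‖ * ‖z i (dualToOperator p φ (delta U (x i)))‖ : ℝ) : ℂ) := by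
      push_cast
      refine Finset.sum_congr rfl fun i _ => ?_
      rw [map_smul, smul_eq_mul, mul_assoc]
      exact congrArg _ (hcz i).symm
    rw [this, Complex.norm_real, Real.norm_of_nonneg (by positivity)]
  rw [h1]
  -- It now suffices to test on `yᵢ` in `F`, where the sum is `φ` at the tensor `∑ |λᵢ| cᵢ δ(xᵢ) ⊗
  -- yᵢ`; its norm is controlled by this very representation, as `‖δ(xᵢ)‖ ≤ 1`.
  refine norm_sum_bidual_le _ _ (mul_nonneg (norm_nonneg φ) (strongNorm_nonneg p l))
    (fun y => ?_) z
  have h2 : ∑ i, (((‖l i‖ : ℂ) * c i) • dualToOperator p φ (delta U (x i))) (y i) =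
      φ (∑ i, ctmul p (((‖l i‖ : ℂ) * c i) • delta U (x i)) (y i)) := by
    simp only [smul_apply, map_sum, ctmul_smul_left, map_smul, dualToOperator_apply]
  rw [h2, mul_assoc]
  refine (φ.le_opNorm_of_le (norm_sum_ctmul_le p _ _)).trans ?_
  gcongr
  · exact weakNorm_nonneg _ y
  · refine strongNorm_smul_le p (F := GInf U) (fun i => ?_) fun i => norm_delta_le _
    rw [norm_mul, hc, mul_one, Complex.norm_real, norm_norm]

variable (F U) in
/-- The map `φ ↦ (x ↦ φ(δ(x) ⊗ ·))`. -/
def dualToCohen : StrongDual ℂ (CompletedChevetSaphar p (GInf U) F) →ₗ[ℂ]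
    CohenSpace p U (StrongDual ℂ F) where
  toFun φ := ⟨fun x => dualToOperator p φ (delta U x),
    isHolomorphic_delta.clm_comp _, _, norm_mem_cohenConstants p φ⟩
  map_add' _ _ := rfl
  map_smul' _ _ := rfl

theorem norm_dualToCohen_le (φ : StrongDual ℂ (CompletedChevetSaphar p (GInf U) F)) :
    ‖dualToCohen p F U φ‖ ≤ ‖φ‖ :=
  cohenNorm_le p (norm_mem_cohenConstants p φ)

theorem dualToCohen_injective : Function.Injective (dualToCohen p F U) := by
  refine (injective_iff_map_eq_zero _).2 fun φ h => dual_eq_zero_of_ctmul p fun γ y => ?_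
  have h0 : dualToOperator p φ = 0 := GInf.clm_ext fun x => congrFun (congrArg Subtype.val h) x
  rw [← dualToOperator_apply, h0]
  rfl

/-! ### From Cohen summing maps to functionals -/

namespace CohenSpace

variable {p} (f : CohenSpace p U (StrongDual ℂ F))

/-- The Cohen inequality for a one-term family with `λ = 1`. It makes the functions `f(·)(y)`
bounded. -/
theorem norm_apply_le {G : Type*} [NormedAddCommGroup G] [NormedSpace ℂ G] (f : CohenSpace p U G)
    (x : U) : ‖f x‖ ≤ ‖f‖ := by
  refine NormedSpace.norm_le_dual_bound ℂ _ (norm_nonneg f) fun ψ => ?_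
  have h := (cohenNorm_mem p f.2.2).2 1 (fun _ => 1) (fun _ => x) fun _ => ψ
  rw [Fin.sum_univ_one, norm_one, one_mul, strongNorm_const_fin_one, norm_one, mul_one] at h
  exact h.trans (mul_le_mul_of_nonneg_left (weakNorm_const_fin_one_le _ ψ) (norm_nonneg f))

/-- The bounded holomorphic function `x ↦ f(x)(y)`. -/
def slice (y : F) : HInf U :=
  HInf.ofBound (fun x => f x y) (f.2.1.clm_comp (ContinuousLinearMap.apply ℂ ℂ y)) (‖f‖ * ‖y‖)
    fun x => (f x).le_of_opNorm_le (f.norm_apply_le x) y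

theorem slice_apply (y : F) (x : U) : f.slice y x = f x y := rfl

theorem slice_add (y y' : F) : f.slice (y + y') = f.slice y + f.slice y' :=
  Subtype.ext (BoundedContinuousFunction.ext fun x => map_add (f x) y y')

theorem slice_smul (c : ℂ) (y : F) : f.slice (c • y) = c • f.slice y :=
  Subtype.ext (BoundedContinuousFunction.ext fun x => map_smul (f x) c y)

/-- The bilinear form `(γ, y) ↦ γ(x ↦ f(x)(y))`. -/
def pairing : GInf U →ₗ[ℂ] F →ₗ[ℂ] ℂ :=
  LinearMap.mk₂ ℂ (fun γ y => γ.1 (f.slice y)) (fun _ _ _ => rfl) (fun _ _ _ => rfl)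
    (fun γ y y' => by rw [slice_add, map_add]) fun c γ y => by rw [slice_smul, map_smul]

theorem pairing_apply (γ : GInf U) (y : F) : f.pairing γ y = γ.1 (f.slice y) := rfl

/-- Each term is at most `‖γᵢ‖ sup_x |f(x)(yᵢ)|`. Almost maximising points reduce the sum to the
Cohen inequality with scalars `‖γᵢ‖` and the `yᵢ` regarded in `F**`, which does not increase their
weak norm. -/
theorem norm_sum_pairing_le {n : ℕ} (γ : Fin n → GInf U) (y : Fin n → F) :
    ‖∑ i, f.pairing (γ i) (y i)‖ ≤ ‖f‖ * (strongNorm p γ * weakNorm (conjIndex p) y) := by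
  -- For empty `U` there are no points to choose, but then `H^∞(U)` is zero.
  rcases isEmpty_or_nonempty U with hU | hU
  · have h0 : ∀ y, f.slice y = 0 := fun y =>
      Subtype.ext (BoundedContinuousFunction.ext fun x => hU.elim x)
    simp only [pairing_apply, h0, map_zero, Finset.sum_const_zero, norm_zero]
    exact mul_nonneg (norm_nonneg f)
      (mul_nonneg (strongNorm_nonneg p γ) (weakNorm_nonneg _ y))
  refine le_of_forall_pos_le_add fun ε hε => ?_
  -- Chosen so that `(∑ ‖γᵢ‖) δ ≤ ε`; the `+ 1` keeps the denominator positive.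
  set δ : ℝ := ε / (∑ i, ‖γ i‖ + 1) with hδ
  have hs : 0 < ∑ i, ‖γ i‖ + 1 := by positivity
  have hδ0 : 0 < δ := by positivity
  have hx : ∀ i, ∃ x : U, ‖f.slice (y i)‖ ≤ ‖f x (y i)‖ + δ := fun i => by
    by_contra! hcon
    have h1 : 0 ≤ ‖f.slice (y i)‖ - δ := by
      have := hcon hU.some
      have := norm_nonneg (f hU.some (y i))
      linarith
    have h2 : ‖f.slice (y i)‖ ≤ ‖f.slice (y i)‖ - δ :=
      HInf.norm_le h1 fun x => by rw [slice_apply]; linarith [hcon x]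
    linarith
  choose x hx using hx
  have hmain := (cohenNorm_mem p f.2.2).2 n (fun i => (‖γ i‖ : ℂ)) x fun i =>
    NormedSpace.inclusionInDoubleDual ℂ F (y i)
  have hl : strongNorm p (fun i => (‖γ i‖ : ℂ)) ≤ strongNorm p γ :=
    strongNorm_mono p fun i => by rw [Complex.norm_real, norm_norm]
  calc ‖∑ i, f.pairing (γ i) (y i)‖ ≤ ∑ i, ‖γ i‖ * (‖f (x i) (y i)‖ + δ) :=
        norm_sum_le_of_le _ fun i _ => (γ i).1.le_opNorm_of_le (hx i)
    _ = ∑ i, ‖γ i‖ * ‖f (x i) (y i)‖ + (∑ i, ‖γ i‖) * δ := by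
        simp only [mul_add, Finset.sum_add_distrib, Finset.sum_mul]
    _ ≤ ‖f‖ * (strongNorm p γ * weakNorm (conjIndex p) y) + ε := by
        refine add_le_add ?_ ?_
        · simp only [Complex.norm_real, norm_norm, NormedSpace.dual_def] at hmain
          refine hmain.trans ?_
          rw [mul_assoc]
          refine mul_le_mul_of_nonneg_left ?_ (norm_nonneg f)
          exact mul_le_mul hl (weakNorm_inclusionInDoubleDual_le _ y) (weakNorm_nonneg _ _)
            (strongNorm_nonneg p γ)
        · rw [hδ, mul_div_assoc', div_le_iff₀ hs]
          nlinarith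

theorem exists_dual : ∃ φ : StrongDual ℂ (CompletedChevetSaphar p (GInf U) F),
    ‖φ‖ ≤ ‖f‖ ∧ dualToCohen p F U φ = f := by
  have hB := exists_dual_of_bilinear p (E := GInf U) (F := F) f.pairing (norm_nonneg f)
  obtain ⟨φ, hφ, h⟩ := hB fun n γ y => f.norm_sum_pairing_le γ y
  refine ⟨φ, hφ, Subtype.ext (funext fun x => ContinuousLinearMap.ext fun y => ?_)⟩
  exact h (delta U x) y

end CohenSpace

variable (F U) in
/-- The isometric isomorphism `φ ↦ (x ↦ φ(δ(x) ⊗ ·))`. -/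
def dualEquivCohen : StrongDual ℂ (CompletedChevetSaphar p (GInf U) F) ≃ₗᵢ[ℂ]
    CohenSpace p U (StrongDual ℂ F) :=
  LinearIsometryEquiv.ofSurjective
    { dualToCohen p F U with
      norm_map' := fun φ => by
        -- For the reverse inequality, the functional rebuilt from the image of `φ` has norm at most
        -- that of the image, and it is `φ` itself by injectivity.
        refine le_antisymm (norm_dualToCohen_le p φ) ?_
        obtain ⟨ψ, hψ, h⟩ := CohenSpace.exists_dual (dualToCohen p F U φ)
        rw [dualToCohen_injective p h] at hψ
        exact hψ }
    fun f => let ⟨φ, _, h⟩ := f.exists_dual; ⟨φ, h⟩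

theorem dualEquivCohen_apply (φ : StrongDual ℂ (CompletedChevetSaphar p (GInf U) F)) (x : U)
    (y : F) : dualEquivCohen p F U φ x y = φ (ctmul p (delta U x) y) := rfl

end Duality

end CohenHolomorphic

end

open CohenHolomorphic

theorem mainTheorem1
    {E : Type*} [NormedAddCommGroup E] [NormedSpace ℂ E] [CompleteSpace E]
    {F : Type*} [NormedAddCommGroup F] [NormedSpace ℂ F] [CompleteSpace F]
    (U : TopologicalSpace.Opens E) (p : ENNReal) [Fact (1 ≤ p)] :
    ∃ Λ : CohenSpace p U (StrongDual ℂ F) ≃ₗᵢ[ℂ]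
        StrongDual ℂ (CompletedChevetSaphar p (GInf U) F),
      (∀ (f : CohenSpace p U (StrongDual ℂ F)) (n : ℕ) (l : Fin n → ℂ) (x : Fin n → U)
        (y : Fin n → F),
        Λ f (∑ i, l i • ctmul p (delta U (x i)) (y i)) = ∑ i, l i * f (x i) (y i)) ∧
      (∀ (φ : StrongDual ℂ (CompletedChevetSaphar p (GInf U) F)) (x : U) (y : F),
        Λ.symm φ x y = φ (ctmul p (delta U x) y)) := by
  refine ⟨(dualEquivCohen p F U).symm, fun f n l x y => ?_, fun φ x y => rfl⟩
  rw [map_sum]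
  refine Finset.sum_congr rfl fun i _ => ?_
  rw [map_smul, smul_eq_mul, ← dualEquivCohen_apply, LinearIsometryEquiv.apply_symm_apply]
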